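/- Let $\alpha\in\mathbb R^n$ be a row vector and $A\in\mathbb R^{n\times n}$, and let $\mathbf 1$ be the column vector of ones. A random variable $X$ is $\mathrm{ME}(\alpha,A)$ distributed, with a representation $(\alpha,A)$ of order $n$, if its law is carried by $[0,\infty)$ and has there the density $f_X(x)=-\alpha A e^{Ax}\mathbf 1\ge 0$, with $\int_0^\infty f_X(x)\,dx=1$; here the entries of $\alpha$ and $A$ are arbitrary real numbers. A representation of $X$ is minimal if $X$ has no representation of smaller order. $X$ is $\mathrm{PH}(\alpha,A)$ distributed if it is $\mathrm{ME}(\alpha,A)$ distributed with $\alpha_i\ge 0$, $\alpha\mathbf 1=1$, $A_{ii}<0$, $A_{ij}\ge 0$ for $i\ne j$, $A\mathbf 1\le 0$ and $A$ non-singular. Such a representation is non-redundant if every state can be visited by the Markov chain with initial distribution $\alpha$ and transient generator $A$, that is, if for every $i$ there is $t\ge 0$ with $(\alpha e^{At})_i>0$. A (complex) eigenvalue of a real square matrix is called dominant if its real part is strictly larger than that of every other distinct eigenvalue; its multiplicity may exceed $1$. The law of $X$ satisfies the dominant eigenvalue condition if, for some minimal representation $(\gamma,G)$ of $X$, the matrix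 $G$ has a dominant eigenvalue. For an eigenvalue $\mu$ of a real square matrix $M$ let $n_\mu(M)$ be the size of the largest Jordan block of $M$ with eigenvalue $\mu$. If $(\beta,M)$ is a representation of $X$, the density has a unique expansion $$f_X(x)=\sum_{\mu}\sum_{j=1}^{n_\mu(M)}c_{\mu,j}\,x^{j-1}e^{\mu x}\qquad(x\ge 0),$$ where $\mu$ runs over the distinct eigenvalues of $M$. We say that a real eigenvalue $\mu$ of $M$ contributes to the density with maximal multiplicity and a positive coefficient if $c_{\mu,n_\mu(M)}$ is real and strictly positive. Lemma. Let $X$ be $\mathrm{PH}(\alpha,A)$ distributed with $(\alpha,A)$ non-redundant. Then the dominant eigenvalue condition holds. More precisely, $A$ has a dominant eigenvalue $-\lambda_1$, which is real, and which contributes to the density with maximal multiplicity and a positive coefficient. Moreover, for every minimal representation $(\gamma,G)$ of $X$, $-\lambda_1$ is the dominant eigenvalue of $G$, its algebraic multiplicity in $G$ equals $n_{-\lambda_1}(A)$, and it contributes to the density with maximal multiplicity and a positive coefficient with respect to $(\gamma,G)$ as well. -/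

import Mathlib

open MeasureTheory

namespace PhaseType

noncomputable section

/-- The function `x ↦ -α A e^{A x} 𝟏`, where `𝟏` is the column vector of ones. -/
def meDensity {n : ℕ} (α : Fin n → ℝ) (A : Matrix (Fin n) (Fin n) ℝ) (x : ℝ) : ℝ :=
  -(Matrix.vecMul α (A * NormedSpace.exp (x • A)) ⬝ᵥ (1 : Fin n → ℝ))

/-- The law `ν` on `ℝ` is matrix-exponential with representation `(α, A)` of order `n`: it is
carried by `[0, ∞)`, where it has the density `-α A e^{A x} 𝟏`, which is non-negative there and
has total mass one (no probability mass at zero). -/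
structure IsME (ν : Measure ℝ) {n : ℕ} (α : Fin n → ℝ) (A : Matrix (Fin n) (Fin n) ℝ) :
    Prop where
  density_nonneg : ∀ x : ℝ, 0 ≤ x → 0 ≤ meDensity α A x
  lintegral_density : ∫⁻ x in Set.Ici (0 : ℝ), ENNReal.ofReal (meDensity α A x) = 1
  law_eq : ν = (volume.restrict (Set.Ici (0 : ℝ))).withDensity
    (fun x => ENNReal.ofReal (meDensity α A x))

/-- The pair `(α, A)` is a representation of the matrix-exponential law `ν`, and `ν` has no
representation of smaller order. -/
def IsMinimalRep (ν : Measure ℝ) {n : ℕ} (α : Fin n → ℝ) (A : Matrix (Fin n) (Fin n) ℝ) : Prop :=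
  IsME ν α A ∧
    ∀ (m : ℕ) (γ : Fin m → ℝ) (G : Matrix (Fin m) (Fin m) ℝ), IsME ν γ G → n ≤ m

/-- The law `ν` is phase-type with (Markovian) representation `(α, A)`. -/
structure IsPH (ν : Measure ℝ) {n : ℕ} (α : Fin n → ℝ) (A : Matrix (Fin n) (Fin n) ℝ) : Prop
    extends IsME ν α A where
  init_nonneg : ∀ i, 0 ≤ α i
  init_sum : ∑ i, α i = 1
  diag_neg : ∀ i, A i i < 0
  offdiag_nonneg : ∀ i j, i ≠ j → 0 ≤ A i j
  row_sum_nonpos : ∀ i, ∑ j, A i j ≤ 0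
  nonsingular : IsUnit A.det

/-- For Markovian `(α, A)`, the `i`-th entry of `α e^{A t}` is the probability that the Markov
chain with initial distribution `α` and transient generator `A` is in state `i` at time `t`. -/
def stateProb {n : ℕ} (α : Fin n → ℝ) (A : Matrix (Fin n) (Fin n) ℝ) (t : ℝ) (i : Fin n) : ℝ :=
  Matrix.vecMul α (NormedSpace.exp (t • A)) i

/-- Every state can be visited by the Markov chain with initial distribution `α` and generator
`A`. -/
def IsNonRedundant {n : ℕ} (α : Fin n → ℝ) (A : Matrix (Fin n) (Fin n) ℝ) : Prop :=
  ∀ i, ∃ t : ℝ, 0 ≤ t ∧ 0 < stateProb α A t i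

/-- A real matrix viewed as a complex matrix. -/
def toComplex {n : ℕ} (A : Matrix (Fin n) (Fin n) ℝ) : Matrix (Fin n) (Fin n) ℂ :=
  A.map Complex.ofReal

/-- The finite set of (distinct, complex) eigenvalues of a real square matrix. -/
def eigs {n : ℕ} (A : Matrix (Fin n) (Fin n) ℝ) : Finset ℂ :=
  (toComplex A).charpoly.roots.toFinset

theorem mem_eigs_iff {n : ℕ} (A : Matrix (Fin n) (Fin n) ℝ) (μ : ℂ) :
    μ ∈ eigs A ↔ Module.End.HasEigenvalue (Matrix.toLin' (toComplex A)) μ := by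
  rw [eigs, Multiset.mem_toFinset, Polynomial.mem_roots (Matrix.charpoly_monic _).ne_zero,
    ← Matrix.mem_spectrum_iff_isRoot_charpoly, Module.End.hasEigenvalue_iff_mem_spectrum,
    Matrix.spectrum_toLin']

/-- The eigenvalue `μ` of `A` has a real part strictly greater than that of every other
(distinct) eigenvalue of `A`; no condition is put on its multiplicity. -/
def IsDominantEigenvalue {n : ℕ} (A : Matrix (Fin n) (Fin n) ℝ) (μ : ℂ) : Prop :=
  μ ∈ eigs A ∧ ∀ κ ∈ eigs A, κ ≠ μ → κ.re < μ.re

/-- The dominant eigenvalue condition: for some minimal representation `(γ, G)` of `ν`, the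
matrix `G` has a single eigenvalue with maximal real part. -/
def DominantEigenvalueCondition (ν : Measure ℝ) : Prop :=
  ∃ (m : ℕ) (γ : Fin m → ℝ) (G : Matrix (Fin m) (Fin m) ℝ),
    IsMinimalRep ν γ G ∧ ∃ μ : ℂ, IsDominantEigenvalue G μ

/-- Algebraic multiplicity of `μ` as an eigenvalue of `A`. -/
def algMult {n : ℕ} (A : Matrix (Fin n) (Fin n) ℝ) (μ : ℂ) : ℕ :=
  (toComplex A).charpoly.rootMultiplicity μ

/-- Size of the largest Jordan block of `A` with eigenvalue `μ`, that is, the multiplicity of `μ`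
as a root of the minimal polynomial; it is `0` if `μ` is not an eigenvalue. -/
def maxJordanBlock {n : ℕ} (A : Matrix (Fin n) (Fin n) ℝ) (μ : ℂ) : ℕ :=
  (minpoly ℂ (toComplex A)).rootMultiplicity μ

/-- The numbers `c μ j` are the coefficients in the expansion
`-α A e^{A x} 𝟏 = ∑_μ ∑_{j = 1}^{n_μ} c_{μ,j} x^{j-1} e^{μ x}` on `[0, ∞)`, where `μ` runs through
the eigenvalues of `A` and `n_μ` is the size of the largest Jordan block of `μ`, so that
`x^{n_μ - 1} e^{μ x}` is the highest term that `μ` can contribute. These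
coefficients (with `μ` an eigenvalue and `1 ≤ j ≤ n_μ`) are uniquely determined. -/
def IsExpansion {n : ℕ} (α : Fin n → ℝ) (A : Matrix (Fin n) (Fin n) ℝ) (c : ℂ → ℕ → ℂ) : Prop :=
  ∀ x : ℝ, 0 ≤ x → (meDensity α A x : ℂ) =
    ∑ μ ∈ eigs A, ∑ j ∈ Finset.Icc 1 (maxJordanBlock A μ),
      c μ j * (x : ℂ) ^ (j - 1) * Complex.exp (μ * x)

/-- The real eigenvalue `r` of `A` contributes to the density `-α A e^{A x} 𝟏` with maximal
multiplicity and with a positive coefficient. -/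
def ContributesMaximally {n : ℕ} (α : Fin n → ℝ) (A : Matrix (Fin n) (Fin n) ℝ) (r : ℝ) : Prop :=
  ∃ (c : ℂ → ℕ → ℂ) (c₀ : ℝ), IsExpansion α A c ∧ 0 < c₀ ∧
    c (r : ℂ) (maxJordanBlock A (r : ℂ)) = (c₀ : ℂ)

end

end PhaseType

/-!
Write `m` for the minimal polynomial of `A`. The shifted matrix `A + c` is non-negative for large
`c`, so by the Neumann series `(s - A)⁻¹ ≥ 0` for real `s > r`, where `r + c` is the spectral
radius of `A + c`. Both facts about the top of the spectrum come from the observation that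
`m(s) (s - A)⁻¹` is a polynomial in `s`. Testing it on the moduli of an eigenvector of maximal
modulus and letting `s` decrease to `r` gives `m(r) = 0`, so that `r` is the dominant eigenvalue,
and the limit of `m(s) (s - A)⁻¹` itself is a matrix `D ≥ 0`
(`exists_isDominantEigenvalue_of_offdiag_nonneg`). With `m = (X - r)^(k+1) M` and `M(r) > 0` one
has `D = (A - r)^k M(A)`, which is non-zero by minimality of `m`, and `A D = r D`.

Since `α e^{At} D = e^{rt} α D`, and every state is charged by `α e^{At}` for a suitable `t`, the
number `α D 𝟏` is positive (`rowSum_pos_of_isNonRedundant`). Up to the positive factor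
`-r / (M(r) k!)` it is the coefficient of `x^k e^{rx}` in the density, as the decomposition of
`e^{Ax}` by the spectral idempotents shows (`exists_isExpansion`). Here `r < 0` because the row
sums are at most zero and `A` is non-singular.

For the minimal representations, let `q` be the monic generator of the ideal of polynomials `p`
with `α g(A) p(A) 𝟏 = 0` for all `g`. Multiplication by `X` on `ℝ[X] / (q)`, in a basis whose
elements add up to the class of `1`, is a representation of order `deg q` (`exists_realization`).
Two representations of one law have the same moments `α A^{k+1} 𝟏`, so `q` divides every polynomial
that annihilates the matrix of a representation. Hence in a minimal representation `q` is both the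
characteristic and the minimal polynomial (`IsMinimalRep.charpoly_eq`). Now `q ∣ m`, and `q` does
not divide `(X - r)^k M` because `α D 𝟏 ≠ 0`; therefore `(X - r)^(k+1)` divides `q`, and passing
from `m` to `q` only changes the top coefficient by a positive factor
(`exists_generator_factorization`).
-/

namespace PhaseType

noncomputable section

open Polynomial

/-! ### The density and its moments -/

/-- The functional `M ↦ α M 𝟏` on square matrices, where `𝟏` is the column vector of ones. -/
def rowSum {n : ℕ} (α : Fin n → ℝ) : Matrix (Fin n) (Fin n) ℝ →ₗ[ℝ] ℝ where
  toFun M := Matrix.vecMul α M ⬝ᵥ (1 : Fin n → ℝ)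
  map_add' M N := by rw [Matrix.vecMul_add, add_dotProduct]
  map_smul' c M := by rw [Matrix.vecMul_smul, smul_dotProduct, RingHom.id_apply]

theorem rowSum_eq_sum {n : ℕ} (α : Fin n → ℝ) (M : Matrix (Fin n) (Fin n) ℝ) :
    rowSum α M = ∑ j, ∑ i, α i * M i j := by
  simp [rowSum, Matrix.vecMul, dotProduct]

theorem meDensity_eq {n : ℕ} (α : Fin n → ℝ) (A : Matrix (Fin n) (Fin n) ℝ) (x : ℝ) :
    meDensity α A x = -rowSum α (A * NormedSpace.exp (x • A)) := rfl

theorem continuous_rowSum {n : ℕ} (α : Fin n → ℝ) : Continuous (rowSum α) := by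
  simp_rw [funext (rowSum_eq_sum α)]
  fun_prop

section

open scoped Matrix.Norms.Operator

theorem hasSum_exp_matrix {n : ℕ} (A : Matrix (Fin n) (Fin n) ℝ) :
    HasSum (fun k : ℕ => ((k.factorial : ℝ)⁻¹) • A ^ k) (NormedSpace.exp A) :=
  NormedSpace.exp_series_hasSum_exp' A

theorem hasSum_exp_matrix_complex {n : ℕ} (A : Matrix (Fin n) (Fin n) ℂ) :
    HasSum (fun k : ℕ => ((k.factorial : ℂ)⁻¹) • A ^ k) (NormedSpace.exp A) :=
  NormedSpace.exp_series_hasSum_exp' A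

theorem hasDerivAt_rowSum_exp {n : ℕ} (α : Fin n → ℝ) (A M : Matrix (Fin n) (Fin n) ℝ) (x : ℝ) :
    HasDerivAt (fun t : ℝ => rowSum α (M * NormedSpace.exp (t • A)))
      (rowSum α (M * A * NormedSpace.exp (x • A))) x := by
  have h : HasDerivAt (fun t : ℝ => NormedSpace.exp (t • A))
      (A * NormedSpace.exp (x • A)) x := hasDerivAt_exp_smul_const' A x
  let T : Matrix (Fin n) (Fin n) ℝ →L[ℝ] ℝ :=
    ⟨(rowSum α).comp (LinearMap.mulLeft ℝ M), (continuous_rowSum α).comp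
      (show Continuous fun N => M * N from continuous_const.mul continuous_id)⟩
  have := T.hasFDerivAt.comp_hasDerivAt x h
  rw [mul_assoc]
  exact this

end

theorem continuous_meDensity {n : ℕ} (α : Fin n → ℝ) (A : Matrix (Fin n) (Fin n) ℝ) :
    Continuous (meDensity α A) :=
  continuous_iff_continuousAt.2 fun x => (hasDerivAt_rowSum_exp α A A x).continuousAt.neg

theorem IsME.meDensity_eq_of_nonneg {ν : Measure ℝ} {m n : ℕ} {α : Fin n → ℝ}
    {A : Matrix (Fin n) (Fin n) ℝ} {γ : Fin m → ℝ} {G : Matrix (Fin m) (Fin m) ℝ}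
    (hA : IsME ν α A) (hG : IsME ν γ G) {x : ℝ} (hx : 0 ≤ x) :
    meDensity α A x = meDensity γ G x := by
  have hm : ∀ {k : ℕ} (β : Fin k → ℝ) (B : Matrix (Fin k) (Fin k) ℝ),
      AEMeasurable (fun x => ENNReal.ofReal (meDensity β B x))
        (volume.restrict (Set.Ici (0 : ℝ))) := fun β B =>
    (continuous_meDensity β B).measurable.ennreal_ofReal.aemeasurable
  have h := (withDensity_eq_iff_of_sigmaFinite (hm α A) (hm γ G)).1
    (hA.law_eq.symm.trans hG.law_eq)
  have h' : meDensity α A =ᵐ[volume.restrict (Set.Ici (0 : ℝ))] meDensity γ G := by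
    filter_upwards [h, ae_restrict_mem measurableSet_Ici] with y hy hy0
    exact (ENNReal.ofReal_eq_ofReal_iff (hA.density_nonneg y hy0)
      (hG.density_nonneg y hy0)).1 hy
  exact Measure.eqOn_of_ae_eq h' (continuous_meDensity α A).continuousOn
    (continuous_meDensity γ G).continuousOn (by simp) hx

/-- The moments from the first one on are, up to sign, the right derivatives of the
density at `0`. -/
theorem rowSum_pow_eq_of_meDensity_eq {m n : ℕ} {α : Fin n → ℝ}
    {A : Matrix (Fin n) (Fin n) ℝ} {γ : Fin m → ℝ} {G : Matrix (Fin m) (Fin m) ℝ}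
    (h : ∀ x : ℝ, 0 ≤ x → meDensity α A x = meDensity γ G x) (k : ℕ) :
    rowSum α (A ^ (k + 1)) = rowSum γ (G ^ (k + 1)) := by
  -- Differentiating the equality of densities `k` times.
  have key : ∀ k : ℕ, ∀ x : ℝ, 0 ≤ x → rowSum α (A ^ (k + 1) * NormedSpace.exp (x • A)) =
      rowSum γ (G ^ (k + 1) * NormedSpace.exp (x • G)) := by
    intro k
    induction k with
    | zero =>
      intro x hx
      simpa [meDensity_eq] using h x hx
    | succ k ih =>
      intro x hx
      have h1 := (hasDerivAt_rowSum_exp α A (A ^ (k + 1)) x).hasDerivWithinAt (s := Set.Ici 0)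
      have h2 := (hasDerivAt_rowSum_exp γ G (G ^ (k + 1)) x).hasDerivWithinAt (s := Set.Ici 0)
      have h3 := h2.congr (fun y hy => ih y hy) (ih x hx)
      rw [pow_succ A, pow_succ G]
      exact (uniqueDiffOn_Ici (0 : ℝ) x hx).eq_deriv _ h1 h3
  simpa using key k 0 le_rfl

theorem rowSum_mul_aeval_eq {m n : ℕ} {α : Fin n → ℝ}
    {A : Matrix (Fin n) (Fin n) ℝ} {γ : Fin m → ℝ} {G : Matrix (Fin m) (Fin m) ℝ}
    (h : ∀ k : ℕ, rowSum α (A ^ (k + 1)) = rowSum γ (G ^ (k + 1))) (p : ℝ[X]) :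
    rowSum α (A * aeval A p) = rowSum γ (G * aeval G p) := by
  simp_rw [aeval_eq_sum_range, Finset.mul_sum, map_sum, mul_smul_comm, map_smul, ← pow_succ', h]

theorem meDensity_eq_of_rowSum_pow_eq {m n : ℕ} {α : Fin n → ℝ}
    {A : Matrix (Fin n) (Fin n) ℝ} {γ : Fin m → ℝ} {G : Matrix (Fin m) (Fin m) ℝ}
    (h : ∀ k : ℕ, rowSum α (A ^ (k + 1)) = rowSum γ (G ^ (k + 1))) :
    meDensity α A = meDensity γ G := by
  funext x
  have key : ∀ {l : ℕ} (β : Fin l → ℝ) (B : Matrix (Fin l) (Fin l) ℝ),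
      HasSum (fun k : ℕ => (k.factorial : ℝ)⁻¹ * x ^ k * rowSum β (B ^ (k + 1)))
        (rowSum β (B * NormedSpace.exp (x • B))) := by
    intro l β B
    have h1 := ((hasSum_exp_matrix (x • B)).mul_left B).map (rowSum β) (continuous_rowSum β)
    convert! h1 using 2 with k
    simp [_root_.smul_pow, pow_succ' B, mul_assoc]
  rw [meDensity_eq, meDensity_eq, (key α A).unique (by simpa only [h] using key γ G)]

theorem IsME.of_meDensity_eq {ν : Measure ℝ} {m n : ℕ} {α : Fin n → ℝ}
    {A : Matrix (Fin n) (Fin n) ℝ} {γ : Fin m → ℝ} {G : Matrix (Fin m) (Fin m) ℝ}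
    (hA : IsME ν α A) (h : meDensity α A = meDensity γ G) : IsME ν γ G :=
  ⟨h ▸ hA.density_nonneg, h ▸ hA.lintegral_density, h ▸ hA.law_eq⟩

/-! ### Complexification -/

/-- The algebra embedding of real into complex matrices. -/
def complexify (n : ℕ) : Matrix (Fin n) (Fin n) ℝ →ₐ[ℝ] Matrix (Fin n) (Fin n) ℂ :=
  (Algebra.ofId ℝ ℂ).mapMatrix

theorem complexify_apply {n : ℕ} (A : Matrix (Fin n) (Fin n) ℝ) :
    complexify n A = toComplex A := rfl

theorem charpoly_toComplex {n : ℕ} (A : Matrix (Fin n) (Fin n) ℝ) :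
    (toComplex A).charpoly = A.charpoly.map (algebraMap ℝ ℂ) :=
  Matrix.charpoly_map A (algebraMap ℝ ℂ)

theorem aeval_toComplex_map {n : ℕ} (A : Matrix (Fin n) (Fin n) ℝ) (p : ℝ[X]) :
    aeval (toComplex A) (p.map (algebraMap ℝ ℂ)) = toComplex (aeval A p) := by
  rw [aeval_map_algebraMap, ← complexify_apply, ← complexify_apply, aeval_algHom_apply]

/-- The minimal polynomial of a real matrix does not change over `ℂ`. -/
theorem minpoly_toComplex {n : ℕ} (A : Matrix (Fin n) (Fin n) ℝ) :
    minpoly ℂ (toComplex A) = (minpoly ℝ A).map (algebraMap ℝ ℂ) := by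
  have hA := Matrix.isIntegral A
  symm
  refine minpoly.unique ℂ _ ((minpoly.monic hA).map _) ?_ fun p hp hpA => ?_
  · rw [aeval_toComplex_map, minpoly.aeval]
    ext; simp [toComplex]
  · -- The polynomial with the real parts of the coefficients of `p` annihilates `A` as well.
    set p' : ℝ[X] := ∑ i ∈ Finset.range (p.natDegree + 1), monomial i (p.coeff i).re with hp'
    have hcoeff : p'.coeff p.natDegree = 1 := by
      simp [hp', finsetSum_coeff, coeff_monomial, hp.coeff_natDegree]
    have hne : p' ≠ 0 := fun h => by simp [h] at hcoeff
    have hdeg : p'.degree ≤ p.degree := by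
      rw [degree_eq_natDegree hp.ne_zero]
      refine (degree_sum_le _ _).trans (Finset.sup_le fun i hi => ?_)
      exact (degree_monomial_le _ _).trans
        (WithBot.coe_le_coe.2 (Nat.lt_succ_iff.1 (Finset.mem_range.1 hi)))
    have hz : aeval A p' = 0 := by
      ext a b
      have h := congrArg (fun M : Matrix (Fin n) (Fin n) ℂ => (M a b).re) hpA
      have hpow : ∀ i : ℕ, (toComplex A ^ i) a b = ((A ^ i) a b : ℂ) := fun i => by
        rw [← complexify_apply, ← map_pow]; rfl
      simp only [hp', map_sum, aeval_monomial, Algebra.algebraMap_eq_smul_one, smul_mul_assoc,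
        one_mul]
      simpa [aeval_eq_sum_range, Matrix.sum_apply, hpow] using h
    rw [degree_map]
    exact (minpoly.degree_le_of_ne_zero ℝ A hne hz).trans hdeg

theorem mem_eigs_iff_isRoot_minpoly {n : ℕ} (A : Matrix (Fin n) (Fin n) ℝ) (μ : ℂ) :
    μ ∈ eigs A ↔ ((minpoly ℝ A).map (algebraMap ℝ ℂ)).IsRoot μ := by
  rw [mem_eigs_iff, Module.End.hasEigenvalue_iff_isRoot, Matrix.minpoly_toLin', minpoly_toComplex]

theorem ofReal_mem_eigs_iff {n : ℕ} (A : Matrix (Fin n) (Fin n) ℝ) (r : ℝ) :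
    (r : ℂ) ∈ eigs A ↔ (minpoly ℝ A).IsRoot r := by
  rw [mem_eigs_iff_isRoot_minpoly]
  exact isRoot_map_iff Complex.ofReal_injective

theorem maxJordanBlock_ofReal {n : ℕ} (A : Matrix (Fin n) (Fin n) ℝ) (r : ℝ) :
    maxJordanBlock A r = (minpoly ℝ A).rootMultiplicity r := by
  rw [maxJordanBlock, minpoly_toComplex]
  exact (eq_rootMultiplicity_map (f := algebraMap ℝ ℂ) Complex.ofReal_injective r).symm

theorem algMult_ofReal {n : ℕ} (A : Matrix (Fin n) (Fin n) ℝ) (r : ℝ) :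
    algMult A r = A.charpoly.rootMultiplicity r := by
  rw [algMult, charpoly_toComplex]
  exact (eq_rootMultiplicity_map (f := algebraMap ℝ ℂ) Complex.ofReal_injective r).symm

/-! ### Perron's theorem for matrices with non-negative off-diagonal entries -/

section

open scoped Matrix.Norms.Operator

theorem hasSum_inverse_one_sub_smul {n : ℕ} [NeZero n] (a : Matrix (Fin n) (Fin n) ℂ) {z : ℂ}
    (hz : (‖z‖₊ : ENNReal) < (spectralRadius ℂ a)⁻¹) :
    HasSum (fun k : ℕ => z ^ k • a ^ k) (Ring.inverse (1 - z • a)) := by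
  obtain ⟨r, hzr, hr⟩ := ENNReal.lt_iff_exists_nnreal_btwn.1 hz
  have hr0 : 0 < r := lt_of_le_of_lt (zero_le (a := ‖z‖₊)) (by exact_mod_cast hzr)
  have H := (spectrum.differentiableOn_inverse_one_sub_smul hr).hasFPowerSeriesOnBall hr0
  have H' := (spectrum.hasFPowerSeriesOnBall_inverse_one_sub_smul ℂ a).exchange_radius H
  have h := H'.hasSum (y := z) (by rw [Metric.mem_eball, edist_zero_right]; exact hzr)
  simp only [ContinuousMultilinearMap.mkPiRing_apply, Finset.prod_const, Finset.card_univ,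
    Fintype.card_fin, zero_add] at h
  exact h

theorem inverse_one_sub_smul_mul_cancel {n : ℕ} (a : Matrix (Fin n) (Fin n) ℂ) {z : ℂ}
    (hz : (‖z‖₊ : ENNReal) < (spectralRadius ℂ a)⁻¹) :
    Ring.inverse (1 - z • a) * (1 - z • a) = 1 :=
  Ring.inverse_mul_cancel _ (spectrum.isUnit_one_sub_smul_of_lt_inv_radius hz)

theorem exists_mem_spectrum_norm_max {n : ℕ} [NeZero n] (a : Matrix (Fin n) (Fin n) ℂ) :
    ∃ μ ∈ spectrum ℂ a, (‖μ‖₊ : ENNReal) = spectralRadius ℂ a :=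
  spectrum.exists_nnnorm_eq_spectralRadius a

end

theorem toComplex_pow_apply {n : ℕ} (B : Matrix (Fin n) (Fin n) ℝ) (k : ℕ) (i j : Fin n) :
    (toComplex B ^ k) i j = ((B ^ k) i j : ℂ) := by
  rw [← complexify_apply, ← map_pow]
  rfl

theorem pow_apply_nonneg {n : ℕ} {B : Matrix (Fin n) (Fin n) ℝ} (hB : ∀ i j, 0 ≤ B i j) (k : ℕ) :
    ∀ i j, 0 ≤ (B ^ k) i j := by
  induction k with
  | zero => intro i j; by_cases h : i = j <;> simp [h]
  | succ k ih =>
    intro i j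
    rw [pow_succ, Matrix.mul_apply]
    exact Finset.sum_nonneg fun l _ => mul_nonneg (ih i l) (hB l j)

theorem map_re_mul_of_mul_toComplex_eq_one {n : ℕ} {S : Matrix (Fin n) (Fin n) ℂ}
    {M : Matrix (Fin n) (Fin n) ℝ} (h : S * toComplex M = 1) : S.map Complex.re * M = 1 := by
  ext i j
  have h5 := congrArg (fun M : Matrix (Fin n) (Fin n) ℂ => (M i j).re) h
  simp only [Matrix.mul_apply, Complex.re_sum] at h5
  simp only [Matrix.mul_apply, Matrix.map_apply]
  convert h5 using 1
  · simp [toComplex]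
  · by_cases h : i = j <;> simp [Matrix.one_apply, h]

/-- A real number beyond the spectral radius of a non-negative matrix has a non-negative
resolvent, by the Neumann series. -/
theorem exists_nonneg_inverse_of_spectralRadius_lt {n : ℕ} [NeZero n]
    {B : Matrix (Fin n) (Fin n) ℝ} (hB : ∀ i j, 0 ≤ B i j) {s : ℝ} (hs0 : 0 < s)
    (hs : spectralRadius ℂ (toComplex B) < (s.toNNReal : ENNReal)) :
    ∃ N : Matrix (Fin n) (Fin n) ℝ, (∀ i j, 0 ≤ N i j) ∧ N * (s • 1 - B) = 1 := by
  have hz : (‖((s⁻¹ : ℝ) : ℂ)‖₊ : ENNReal) < (spectralRadius ℂ (toComplex B))⁻¹ := by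
    have h1 : ‖((s⁻¹ : ℝ) : ℂ)‖₊ = (s.toNNReal)⁻¹ := by
      apply NNReal.eq
      rw [coe_nnnorm, Complex.norm_real, Real.norm_of_nonneg (inv_nonneg.2 hs0.le), NNReal.coe_inv,
        Real.coe_toNNReal _ hs0.le]
    rw [h1, ENNReal.coe_inv (Real.toNNReal_pos.2 hs0).ne']
    exact ENNReal.inv_lt_inv.2 hs
  have hsum := hasSum_inverse_one_sub_smul (toComplex B) hz
  have h4 : 1 - ((s⁻¹ : ℝ) : ℂ) • toComplex B = toComplex (1 - s⁻¹ • B) := by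
    rw [← complexify_apply, ← complexify_apply, map_sub, map_one, map_smul, Complex.coe_smul]
  have hinv := inverse_one_sub_smul_mul_cancel (toComplex B) hz
  rw [h4] at hinv hsum
  generalize Ring.inverse (toComplex (1 - s⁻¹ • B)) = S at hsum hinv
  refine ⟨s⁻¹ • S.map Complex.re, fun i j => ?_, ?_⟩
  · have h1 : HasSum (fun k : ℕ => s⁻¹ ^ k * (B ^ k) i j) (S i j).re := by
      have h2 := Complex.hasSum_re (Pi.hasSum.1 (Pi.hasSum.1 hsum i) j)
      convert! h2 using 2 with k
      simp [toComplex_pow_apply, ← Complex.ofReal_pow]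
    exact mul_nonneg (inv_nonneg.2 hs0.le) (h1.nonneg fun k =>
      mul_nonneg (pow_nonneg (inv_nonneg.2 hs0.le) k) (pow_apply_nonneg hB k i j))
  · rw [Matrix.smul_mul, ← Matrix.mul_smul, smul_sub, smul_smul, inv_mul_cancel₀ hs0.ne', one_smul]
    exact map_re_mul_of_mul_toComplex_eq_one hinv

/-- If `p` annihilates `A`, then `p(s) (s - A)⁻¹` is the value at `A` of `(p - p(s)) / (X - s)`,
whose coefficients are polynomials in `s`. -/
theorem sub_mul_aeval_divByMonic {n : ℕ} (A : Matrix (Fin n) (Fin n) ℝ) (p : ℝ[X]) (s : ℝ) :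
    (s • 1 - A) * aeval A (p /ₘ (X - C s)) = p.eval s • 1 - aeval A p := by
  have h := congrArg (aeval A) (X_sub_C_mul_divByMonic_eq_sub_modByMonic p s)
  rw [modByMonic_X_sub_C_eq_C_eval, map_mul, map_sub, map_sub, aeval_X, aeval_C, aeval_C,
    Algebra.algebraMap_eq_smul_one, Algebra.algebraMap_eq_smul_one] at h
  rw [← neg_sub A, neg_mul, h, neg_sub]

theorem aeval_minpoly_divByMonic_ne_zero {n : ℕ} [NeZero n] (A : Matrix (Fin n) (Fin n) ℝ)
    {s : ℝ} (hs : (minpoly ℝ A).IsRoot s) : aeval A (minpoly ℝ A /ₘ (X - C s)) ≠ 0 := by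
  have hA := Matrix.isIntegral A
  intro h
  have hne : minpoly ℝ A /ₘ (X - C s) ≠ 0 := by
    intro h0
    have := mul_divByMonic_eq_iff_isRoot.2 hs
    rw [h0, mul_zero] at this
    exact minpoly.ne_zero hA this.symm
  exact absurd (minpoly.degree_le_of_ne_zero ℝ A hne h)
    (not_le.2 (degree_divByMonic_lt _ _ (minpoly.ne_zero hA) (by simp)))

theorem continuous_aeval_divByMonic {n : ℕ} (A : Matrix (Fin n) (Fin n) ℝ) (p : ℝ[X])
    (i j : Fin n) : Continuous fun s : ℝ => aeval A (p /ₘ (X - C s)) i j := by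
  have h : ∀ s : ℝ, aeval A (p /ₘ (X - C s)) i j = ∑ k ∈ Finset.range (p.natDegree + 1),
      (∑ l ∈ Finset.Icc (k + 1) p.natDegree, s ^ (l - (k + 1)) * p.coeff l) * (A ^ k) i j := by
    intro s
    rw [aeval_eq_sum_range' (n := p.natDegree + 1), Matrix.sum_apply]
    · simp [coeff_divByMonic_X_sub_C]
    · rw [natDegree_divByMonic _ (monic_X_sub_C s)]
      omega
  simp_rw [h]
  fun_prop

/-- A monic real polynomial is positive to the right of its real roots. -/
theorem eval_pos_of_forall_not_isRoot {p : ℝ[X]} (hp : p.Monic) {s : ℝ}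
    (h : ∀ u, s ≤ u → ¬ p.IsRoot u) : 0 < p.eval s := by
  by_contra! hcon
  rcases Nat.eq_zero_or_pos p.natDegree with h0 | h0
  · rw [(hp.natDegree_eq_zero).1 h0] at hcon
    rw [eval_one] at hcon
    linarith
  · have ht := p.tendsto_atTop_of_leadingCoeff_nonneg (natDegree_pos_iff_degree_pos.1 h0)
      (by simp [hp.leadingCoeff])
    obtain ⟨t, hst, ht⟩ := ((Filter.eventually_ge_atTop s).and
      (ht.eventually_ge_atTop 0)).exists
    obtain ⟨u, hu, hu0⟩ := intermediate_value_Icc hst p.continuous.continuousOn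
      (show (0 : ℝ) ∈ Set.Icc _ _ from ⟨hcon, ht⟩)
    exact h u hu.1 hu0

theorem aeval_minpoly_divByMonic_eq_smul {n : ℕ} {A N : Matrix (Fin n) (Fin n) ℝ} {s : ℝ}
    (hN : N * (s • 1 - A) = 1) :
    aeval A (minpoly ℝ A /ₘ (X - C s)) = (minpoly ℝ A).eval s • N := by
  have h := congrArg (N * ·) (sub_mul_aeval_divByMonic A (minpoly ℝ A) s)
  simpa [← mul_assoc, hN, minpoly.aeval] using h

theorem exists_nonneg_shift {n : ℕ} {A : Matrix (Fin n) (Fin n) ℝ}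
    (hA : ∀ i j, i ≠ j → 0 ≤ A i j) : ∃ c : ℝ, ∀ i j, 0 ≤ (A + c • 1) i j := by
  refine ⟨∑ i, |A i i|, fun i j => ?_⟩
  rcases eq_or_ne i j with rfl | h
  · have := Finset.single_le_sum (f := fun i => |A i i|) (fun i _ => abs_nonneg _)
      (Finset.mem_univ i)
    simp only [Matrix.add_apply, Matrix.smul_apply, Matrix.one_apply_eq, smul_eq_mul, mul_one]
    linarith [neg_abs_le (A i i)]
  · simpa [h] using hA i j h

/-- Suppose that the resolvent of `A` is non-negative on `(r, ∞)`, and that `r v ≤ A v` for some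
non-zero `v ≥ 0`. For `s > r` the minimal polynomial `m` is positive and
`m(s) v = m(s) (s - A)⁻¹ (s - A) v ≤ (s - r) m(s) (s - A)⁻¹ v`. As `m(s) (s - A)⁻¹` is a polynomial
in `s`, the limit `s → r` gives `m(r) = 0`, and the limit of `m(s) (s - A)⁻¹` is non-negative. -/
theorem isRoot_minpoly_of_le_mulVec {n : ℕ} [NeZero n] {A : Matrix (Fin n) (Fin n) ℝ} {r : ℝ}
    (hN : ∀ s, r < s → ∃ N : Matrix (Fin n) (Fin n) ℝ, (∀ i j, 0 ≤ N i j) ∧ N * (s • 1 - A) = 1)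
    {v : Fin n → ℝ} (hv : ∀ i, 0 ≤ v i) (hv0 : v ≠ 0)
    (hAv : ∀ i, r * v i ≤ (A.mulVec v) i) :
    (minpoly ℝ A).IsRoot r ∧ ∀ i j, 0 ≤ aeval A (minpoly ℝ A /ₘ (X - C r)) i j := by
  have hnoroot : ∀ s, r < s → ¬ (minpoly ℝ A).IsRoot s := by
    intro s hs hroot
    obtain ⟨N, -, hN1⟩ := hN s hs
    apply aeval_minpoly_divByMonic_ne_zero A hroot
    rw [aeval_minpoly_divByMonic_eq_smul hN1, hroot, zero_smul]
  have hpos : ∀ s, r < s → 0 < (minpoly ℝ A).eval s := fun s hs =>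
    eval_pos_of_forall_not_isRoot (minpoly.monic (Matrix.isIntegral A))
      fun u hu => hnoroot u (hs.trans_le hu)
  have hg : ∀ s, r < s → ∀ i j, 0 ≤ aeval A (minpoly ℝ A /ₘ (X - C s)) i j := by
    intro s hs i j
    obtain ⟨N, hN0, hN1⟩ := hN s hs
    rw [aeval_minpoly_divByMonic_eq_smul hN1]
    exact mul_nonneg (hpos s hs).le (hN0 i j)
  refine ⟨le_antisymm ?_ ?_, fun i j => ?_⟩
  · obtain ⟨i, hi⟩ := Function.ne_iff.1 hv0
    have hi : 0 < v i := lt_of_le_of_ne (hv i) (Ne.symm hi)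
    -- `m(s) v = g_s(A) (s - A) v ≤ (s - r) g_s(A) v` for `s > r`, where
    -- `g_s = (m - m(s)) / (X - s)`.
    have hle : ∀ s, r < s → (minpoly ℝ A).eval s * v i ≤
        (s - r) * ∑ j, aeval A (minpoly ℝ A /ₘ (X - C s)) i j * v j := by
      intro s hs
      obtain ⟨N, hN0, hN1⟩ := hN s hs
      have h1 : aeval A (minpoly ℝ A /ₘ (X - C s)) * (s • 1 - A) =
          (minpoly ℝ A).eval s • 1 := by
        rw [aeval_minpoly_divByMonic_eq_smul hN1, Matrix.smul_mul, hN1]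
      have h2 := congrArg (fun M : Matrix (Fin n) (Fin n) ℝ => (M.mulVec v) i) h1
      simp only [← Matrix.mulVec_mulVec, Matrix.smul_mulVec, Matrix.one_mulVec] at h2
      rw [Pi.smul_apply, smul_eq_mul] at h2
      rw [← h2, Finset.mul_sum, Matrix.mulVec, dotProduct]
      refine Finset.sum_le_sum fun j _ => ?_
      rw [mul_left_comm]
      refine mul_le_mul_of_nonneg_left ?_ (hg s hs i j)
      rw [Matrix.sub_mulVec, Matrix.smul_mulVec, Matrix.one_mulVec]
      simp only [Pi.sub_apply, Pi.smul_apply, smul_eq_mul]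
      linarith [hAv j]
    have hlim := le_of_tendsto_of_tendsto (b := nhdsWithin r (Set.Ioi r))
      (((minpoly ℝ A).continuous.mul continuous_const).tendsto r |>.mono_left nhdsWithin_le_nhds)
      ((show Continuous fun s => (s - r) *
          ∑ j, aeval A (minpoly ℝ A /ₘ (X - C s)) i j * v j from
        (continuous_id.sub continuous_const).mul (continuous_finsetSum _ fun j _ =>
          (continuous_aeval_divByMonic A (minpoly ℝ A) i j).mul continuous_const)).tendsto r
        |>.mono_left nhdsWithin_le_nhds)
      (Filter.eventually_of_mem self_mem_nhdsWithin hle)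
    rw [sub_self, zero_mul] at hlim
    exact nonpos_of_mul_nonpos_left hlim hi
  · exact ge_of_tendsto (((minpoly ℝ A).continuous.tendsto r).mono_left nhdsWithin_le_nhds)
      (Filter.eventually_of_mem (self_mem_nhdsWithin (s := Set.Ioi r)) fun s hs => (hpos s hs).le)
  · exact ge_of_tendsto (((continuous_aeval_divByMonic A (minpoly ℝ A) i j).tendsto r).mono_left
      nhdsWithin_le_nhds)
      (Filter.eventually_of_mem (self_mem_nhdsWithin (s := Set.Ioi r)) fun s hs => hg s hs i j)

theorem mem_eigs_iff_mem_spectrum {n : ℕ} (A : Matrix (Fin n) (Fin n) ℝ) (μ : ℂ) :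
    μ ∈ eigs A ↔ μ ∈ spectrum ℂ (toComplex A) := by
  rw [mem_eigs_iff, Module.End.hasEigenvalue_iff_mem_spectrum, Matrix.spectrum_toLin']

open scoped ComplexOrder in
/-- Perron's theorem. After a shift by `c` the matrix is non-negative, `r + c` is its spectral
radius, and the disc `|κ + c| ≤ r + c` meets the line `Re κ = r` only in `r`. -/
theorem exists_isDominantEigenvalue_of_offdiag_nonneg {n : ℕ} [NeZero n]
    {A : Matrix (Fin n) (Fin n) ℝ} (hA : ∀ i j, i ≠ j → 0 ≤ A i j) :
    ∃ r : ℝ, IsDominantEigenvalue A (r : ℂ) ∧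
      ∀ i j, 0 ≤ aeval A (minpoly ℝ A /ₘ (X - C r)) i j := by
  obtain ⟨c, hB⟩ := exists_nonneg_shift hA
  set B := A + c • 1 with hBdef
  obtain ⟨μ, hμ, hρ⟩ := exists_mem_spectrum_norm_max (toComplex B)
  have hmax : ∀ κ ∈ spectrum ℂ (toComplex B), ‖κ‖ ≤ ‖μ‖ := by
    intro κ hκ
    have h : (‖κ‖₊ : ENNReal) ≤ spectralRadius ℂ (toComplex B) :=
      le_iSup₂ (f := fun k (_ : k ∈ spectrum ℂ (toComplex B)) => (‖k‖₊ : ENNReal)) κ hκ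
    rw [← hρ] at h
    exact_mod_cast h
  have hN : ∀ s, ‖μ‖ - c < s → ∃ N : Matrix (Fin n) (Fin n) ℝ,
      (∀ i j, 0 ≤ N i j) ∧ N * (s • 1 - A) = 1 := by
    intro s hs
    have hs' : ‖μ‖ < s + c := by linarith
    have h0 : 0 < s + c := (norm_nonneg μ).trans_lt hs'
    obtain ⟨N, hN0, hN1⟩ := exists_nonneg_inverse_of_spectralRadius_lt hB h0 (by
      rw [← hρ, ENNReal.coe_lt_coe, ← NNReal.coe_lt_coe, coe_nnnorm, Real.coe_toNNReal _ h0.le]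
      exact hs')
    refine ⟨N, hN0, ?_⟩
    rw [hBdef, add_smul, add_sub_add_right_eq_sub] at hN1
    exact hN1
  -- The moduli of the entries of an eigenvector for `μ`.
  obtain ⟨z, hz⟩ := ((mem_eigs_iff B μ).1
    ((mem_eigs_iff_mem_spectrum B μ).2 hμ)).exists_hasEigenvector
  have hz1 : (toComplex B).mulVec z = μ • z := by simpa using hz.apply_eq_smul
  have hroot := isRoot_minpoly_of_le_mulVec hN (v := fun i => ‖z i‖) (fun i => norm_nonneg _)
    (fun h => hz.2 (funext fun i => norm_eq_zero.1 (congrFun h i))) (by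
      intro i
      have h1 : ‖μ‖ * ‖z i‖ ≤ ∑ j, B i j * ‖z j‖ := by
        rw [← norm_mul, ← smul_eq_mul, ← Pi.smul_apply, ← hz1, Matrix.mulVec, dotProduct]
        refine (norm_sum_le _ _).trans (Finset.sum_le_sum fun j _ => ?_)
        rw [norm_mul, toComplex, Matrix.map_apply, Complex.norm_real, Real.norm_of_nonneg (hB i j)]
      have h2 : ∑ j, B i j * ‖z j‖ = A.mulVec (fun i => ‖z i‖) i + c * ‖z i‖ := by
        have : B.mulVec (fun i => ‖z i‖) i = A.mulVec (fun i => ‖z i‖) i + c * ‖z i‖ := by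
          rw [hBdef, Matrix.add_mulVec, Matrix.smul_mulVec, Matrix.one_mulVec]
          rfl
        exact this
      linarith)
  refine ⟨‖μ‖ - c, ⟨(ofReal_mem_eigs_iff _ _).2 hroot.1, fun κ hκ hne => ?_⟩, hroot.2⟩
  have hκB : κ + c ∈ spectrum ℂ (toComplex B) := by
    have h1 := (spectrum.add_mem_add_iff (s := (c : ℂ))).2 ((mem_eigs_iff_mem_spectrum A κ).1 hκ)
    convert! h1 using 1
    rw [hBdef, ← complexify_apply, ← complexify_apply, map_add, map_smul, map_one, add_comm,
      Algebra.algebraMap_eq_smul_one, Complex.coe_smul]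
  have h1 := hmax _ hκB
  by_contra! hre
  rw [Complex.ofReal_re] at hre
  have h2 : (κ + c).re = κ.re + c := by simp
  have h3 := Complex.re_le_norm (κ + c)
  have h4 : (κ + c).re = ‖κ + c‖ := by linarith
  have h5 : 0 ≤ κ + c := Complex.re_eq_norm.1 h4
  have h6 : κ.im = 0 := by simpa using (Complex.nonneg_iff.1 h5).2.symm
  apply hne
  apply Complex.ext
  · rw [Complex.ofReal_re]; linarith
  · rw [h6, Complex.ofReal_im]

/-! ### Transition matrices and non-redundancy -/

theorem exp_apply_nonneg_of_nonneg {n : ℕ} {B : Matrix (Fin n) (Fin n) ℝ} (hB : ∀ i j, 0 ≤ B i j)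
    (i j : Fin n) : 0 ≤ NormedSpace.exp B i j :=
  (Pi.hasSum.1 (Pi.hasSum.1 (hasSum_exp_matrix B) i) j).nonneg fun k =>
    mul_nonneg (by positivity) (pow_apply_nonneg hB k i j)

theorem exp_smul_mul_of_mul_eq_smul {n : ℕ} {A D : Matrix (Fin n) (Fin n) ℝ} {r : ℝ}
    (hD : A * D = r • D) (t : ℝ) : NormedSpace.exp (t • A) * D = Real.exp (t * r) • D := by
  have hpow : ∀ k : ℕ, (t • A) ^ k * D = (t * r) ^ k • D := by
    intro k
    induction k with
    | zero => simp
    | succ k ih =>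
      rw [pow_succ, mul_assoc, Matrix.smul_mul, hD, smul_smul, Matrix.mul_smul, ih, smul_smul,
        pow_succ, mul_comm]
  have h1 := (hasSum_exp_matrix (t • A)).mul_right D
  have h2 : HasSum (fun k : ℕ => ((k.factorial : ℝ)⁻¹ • (t * r) ^ k) • D)
      (Real.exp (t * r) • D) := by
    rw [Real.exp_eq_exp_ℝ]
    exact (NormedSpace.exp_series_hasSum_exp' (𝕂 := ℝ) (t * r)).smul_const D
  refine h1.unique ?_
  convert! h2 using 2 with k
  rw [Matrix.smul_mul, hpow, smul_assoc]

theorem exp_add_smul_one {n : ℕ} (A : Matrix (Fin n) (Fin n) ℝ) (c : ℝ) :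
    NormedSpace.exp (A + c • (1 : Matrix (Fin n) (Fin n) ℝ)) =
      Real.exp c • NormedSpace.exp A := by
  have h := exp_smul_mul_of_mul_eq_smul (A := (1 : Matrix (Fin n) (Fin n) ℝ)) (D := 1) (r := 1)
    (by simp) c
  rw [mul_one, mul_one] at h
  rw [Matrix.exp_add_of_commute _ _ ((Commute.one_right A).smul_right c), h, Matrix.mul_smul,
    mul_one]

/-- The transition matrices of a Markov chain are non-negative. -/
theorem exp_smul_apply_nonneg {n : ℕ} {A : Matrix (Fin n) (Fin n) ℝ}
    (hA : ∀ i j, i ≠ j → 0 ≤ A i j) {t : ℝ} (ht : 0 ≤ t) (i j : Fin n) :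
    0 ≤ NormedSpace.exp (t • A) i j := by
  obtain ⟨c, hc⟩ := exists_nonneg_shift
    (A := t • A) (fun i j hij => mul_nonneg ht (hA i j hij))
  have h := exp_apply_nonneg_of_nonneg hc i j
  rw [exp_add_smul_one] at h
  exact nonneg_of_mul_nonneg_right h (Real.exp_pos c)

/-- If the Markov chain can reach every state, then a non-zero non-negative matrix of eigenvectors
of its generator is seen by the initial distribution: `α e^{At} D = e^{rt} α D`, and the left side
has a positive entry for a suitable `t`. -/
theorem rowSum_pos_of_isNonRedundant {n : ℕ} {α : Fin n → ℝ} {A D : Matrix (Fin n) (Fin n) ℝ}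
    (hα : ∀ i, 0 ≤ α i) (hA : ∀ i j, i ≠ j → 0 ≤ A i j) (hNR : IsNonRedundant α A) {r : ℝ}
    (hAD : A * D = r • D) (hD : ∀ i j, 0 ≤ D i j) (hD0 : D ≠ 0) : 0 < rowSum α D := by
  obtain ⟨i, j, hij⟩ : ∃ i j, D i j ≠ 0 := by
    by_contra! h
    exact hD0 (Matrix.ext h)
  obtain ⟨t, ht, hti⟩ := hNR i
  have h1 : rowSum α (NormedSpace.exp (t • A) * D) = Real.exp (t * r) * rowSum α D := by
    rw [exp_smul_mul_of_mul_eq_smul hAD, map_smul, smul_eq_mul]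
  have h2 : rowSum α (NormedSpace.exp (t • A) * D) = ∑ l, ∑ k, stateProb α A t k * D k l := by
    simp only [rowSum, LinearMap.coe_mk, AddHom.coe_mk, ← Matrix.vecMul_vecMul, dotProduct,
      Pi.one_apply, mul_one]
    rfl
  have hst : ∀ k, 0 ≤ stateProb α A t k := fun k => by
    rw [stateProb, Matrix.vecMul, dotProduct]
    exact Finset.sum_nonneg fun l _ => mul_nonneg (hα l) (exp_smul_apply_nonneg hA ht l k)
  have hnn : ∀ k l, 0 ≤ stateProb α A t k * D k l := fun k l => mul_nonneg (hst k) (hD k l)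
  have h3 : 0 < ∑ l, ∑ k, stateProb α A t k * D k l :=
    Finset.sum_pos' (fun l _ => Finset.sum_nonneg fun k _ => hnn k l) ⟨j, Finset.mem_univ j,
      Finset.sum_pos' (fun k _ => hnn k j) ⟨i, Finset.mem_univ i,
        mul_pos hti (lt_of_le_of_ne (hD i j) hij.symm)⟩⟩
  rw [← h2, h1] at h3
  exact pos_of_mul_pos_right h3 (Real.exp_pos _).le

/-- An eigenvalue of a subgenerator with a non-negative eigenvector is at most zero: compare at a
maximal entry of the eigenvector. -/
theorem eigenvalue_nonpos_of_row_sum_nonpos {n : ℕ} {A : Matrix (Fin n) (Fin n) ℝ}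
    (hA : ∀ i j, i ≠ j → 0 ≤ A i j) (hrow : ∀ i, ∑ j, A i j ≤ 0) {r : ℝ} {v : Fin n → ℝ}
    (hv : ∀ i, 0 ≤ v i) (hv0 : v ≠ 0) (hAv : A.mulVec v = r • v) : r ≤ 0 := by
  obtain ⟨j, hj⟩ := Function.ne_iff.1 hv0
  obtain ⟨i, -, hi⟩ := Finset.exists_max_image Finset.univ v ⟨j, Finset.mem_univ j⟩
  have hpos : 0 < v i := (lt_of_le_of_ne (hv j) (Ne.symm hj)).trans_le (hi j (Finset.mem_univ j))
  have h1 : r * v i = ∑ j, A i j * v j := (congrFun hAv i).symm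
  have h2 : ∑ j, A i j * v j ≤ ∑ j, A i j * v i := by
    refine Finset.sum_le_sum fun j _ => ?_
    rcases eq_or_ne i j with rfl | h
    · exact le_rfl
    · exact mul_le_mul_of_nonneg_left (hi j (Finset.mem_univ j)) (hA i j h)
  rw [← Finset.sum_mul] at h2
  have h3 := mul_nonpos_of_nonpos_of_nonneg (hrow i) hpos.le
  exact nonpos_of_mul_nonpos_left (by linarith) hpos

theorem eigenvalue_nonpos_of_mul_eq_smul {n : ℕ} {A D : Matrix (Fin n) (Fin n) ℝ}
    (hA : ∀ i j, i ≠ j → 0 ≤ A i j) (hrow : ∀ i, ∑ j, A i j ≤ 0) {r : ℝ} (hAD : A * D = r • D)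
    (hD : ∀ i j, 0 ≤ D i j) (hD0 : D ≠ 0) : r ≤ 0 := by
  obtain ⟨i, j, hij⟩ : ∃ i j, D i j ≠ 0 := by
    by_contra! h
    exact hD0 (Matrix.ext h)
  refine eigenvalue_nonpos_of_row_sum_nonpos hA hrow (v := fun i => D i j) (fun i => hD i j)
    (fun h => hij (congrFun h i)) (funext fun i => ?_)
  exact congrFun (congrFun hAD i) j

/-! ### The expansion of the density -/

theorem hasSum_exp_smul {n : ℕ} (x : ℂ) (N : Matrix (Fin n) (Fin n) ℂ)
    (E : Matrix (Fin n) (Fin n) ℂ) :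
    HasSum (fun k : ℕ => (x ^ k / (k.factorial : ℂ)) • (N ^ k * E))
      (NormedSpace.exp (x • N) * E) := by
  convert! (hasSum_exp_matrix_complex (x • N)).mul_right E using 2 with k
  rw [_root_.smul_pow, smul_smul, Matrix.smul_mul, div_eq_inv_mul]

theorem exp_smul_one_complex {n : ℕ} (z : ℂ) :
    NormedSpace.exp (z • (1 : Matrix (Fin n) (Fin n) ℂ)) = Complex.exp z • 1 := by
  have h1 := hasSum_exp_smul z (1 : Matrix (Fin n) (Fin n) ℂ) 1
  rw [mul_one] at h1
  refine h1.unique ?_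
  have h2 : HasSum (fun k : ℕ => z ^ k / (k.factorial : ℂ)) (Complex.exp z) := by
    rw [Complex.exp_eq_exp_ℂ]
    exact NormedSpace.expSeries_div_hasSum_exp z
  simpa using h2.smul_const (1 : Matrix (Fin n) (Fin n) ℂ)

/-- On a generalized eigenspace the exponential is a polynomial times a scalar exponential. -/
theorem exp_smul_mul_of_pow_mul_eq_zero {n : ℕ} {H E : Matrix (Fin n) (Fin n) ℂ} {μ : ℂ} {k : ℕ}
    (h : (H - μ • 1) ^ k * E = 0) (x : ℂ) :
    NormedSpace.exp (x • H) * E = ∑ j ∈ Finset.range k,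
      (x ^ j / (j.factorial : ℂ) * Complex.exp (μ * x)) • ((H - μ • 1) ^ j * E) := by
  have h1 : x • H = (μ * x) • (1 : Matrix (Fin n) (Fin n) ℂ) + x • (H - μ • 1) := by
    rw [smul_sub, smul_smul, mul_comm x μ, add_sub_cancel]
  have h2 : NormedSpace.exp (x • (H - μ • 1)) * E =
      ∑ j ∈ Finset.range k, (x ^ j / (j.factorial : ℂ)) • ((H - μ • 1) ^ j * E) := by
    refine (hasSum_exp_smul x _ E).unique (hasSum_sum_of_ne_finset_zero fun j hj => ?_)
    obtain ⟨l, rfl⟩ := Nat.exists_eq_add_of_le (not_lt.1 (fun h => hj (Finset.mem_range.2 h)))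
    rw [add_comm k l, pow_add (H - μ • 1), mul_assoc, h, mul_zero, smul_zero]
  rw [h1, Matrix.exp_add_of_commute _ _ ((Commute.one_left _).smul_left _), exp_smul_one_complex,
    Matrix.smul_mul, one_mul, Matrix.smul_mul, h2, Finset.smul_sum]
  refine Finset.sum_congr rfl fun j _ => ?_
  rw [smul_smul, mul_comm]

theorem toComplex_exp_smul {n : ℕ} (G : Matrix (Fin n) (Fin n) ℝ) (x : ℝ) :
    toComplex (NormedSpace.exp (x • G)) = NormedSpace.exp ((x : ℂ) • toComplex G) := by
  have hc : Continuous (complexify n) := by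
    refine continuous_matrix fun i j => ?_
    exact Complex.continuous_ofReal.comp (continuous_id.matrix_elem i j)
  refine ((hasSum_exp_matrix (x • G)).map (complexify n) hc).unique ?_
  convert! hasSum_exp_matrix_complex ((x : ℂ) • toComplex G) using 2 with k
  simp only [Function.comp_apply, map_smul, map_pow, complexify_apply]
  rw [← Complex.coe_smul, ← Complex.coe_smul]
  simp

/-- The functional `rowSum γ`, extended to complex matrices. -/
def rowSumComplex {n : ℕ} (γ : Fin n → ℝ) : Matrix (Fin n) (Fin n) ℂ →ₗ[ℂ] ℂ where
  toFun M := ∑ j, ∑ i, (γ i : ℂ) * M i j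
  map_add' M N := by simp [mul_add, Finset.sum_add_distrib]
  map_smul' c M := by simp [Finset.mul_sum, mul_left_comm]

theorem rowSumComplex_toComplex {n : ℕ} (γ : Fin n → ℝ) (M : Matrix (Fin n) (Fin n) ℝ) :
    rowSumComplex γ (toComplex M) = (rowSum γ M : ℂ) := by
  rw [rowSum_eq_sum]
  simp [rowSumComplex, toComplex]

theorem minpoly_map_eq_prod {n : ℕ} (G : Matrix (Fin n) (Fin n) ℝ) :
    (minpoly ℝ G).map (algebraMap ℝ ℂ) = ∏ μ ∈ eigs G, (X - C μ) ^ maxJordanBlock G μ := by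
  have hmonic : ((minpoly ℝ G).map (algebraMap ℝ ℂ)).Monic :=
    (minpoly.monic (Matrix.isIntegral G)).map _
  have hroots : eigs G = ((minpoly ℝ G).map (algebraMap ℝ ℂ)).roots.toFinset := by
    ext μ
    rw [mem_eigs_iff_isRoot_minpoly, Multiset.mem_toFinset, mem_roots hmonic.ne_zero]
  have h := (IsAlgClosed.splits ((minpoly ℝ G).map (algebraMap ℝ ℂ))).eq_prod_roots_of_monic hmonic
  rw [Finset.prod_multiset_map_count] at h
  rw [hroots]
  refine h.trans (Finset.prod_congr rfl fun μ _ => ?_)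
  rw [count_roots, maxJordanBlock, minpoly_toComplex]

theorem mul_aeval_eq_add {n : ℕ} (G : Matrix (Fin n) (Fin n) ℝ) (r : ℝ) (p : ℝ[X]) :
    G * aeval G p = r • aeval G p + aeval G ((X - C r) * p) := by
  rw [map_mul, map_sub, aeval_X, aeval_C, Algebra.algebraMap_eq_smul_one, sub_mul,
    Matrix.smul_mul, one_mul, add_sub_cancel]

theorem mul_aeval_eq_smul {n : ℕ} {G : Matrix (Fin n) (Fin n) ℝ} {r : ℝ} {k : ℕ} {M : ℝ[X]}
    (hm : minpoly ℝ G = (X - C r) ^ (k + 1) * M) :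
    G * aeval G ((X - C r) ^ k * M) = r • aeval G ((X - C r) ^ k * M) := by
  rw [mul_aeval_eq_add G r, ← mul_assoc, ← pow_succ', ← hm, minpoly.aeval, add_zero]

/-- The top coefficient of a real eigenvalue `r` is read off from the image `(G - r)^k M(G)` of the
highest nilpotent power on its generalized eigenspace. -/
theorem exists_isExpansion {n : ℕ} (γ : Fin n → ℝ) {G : Matrix (Fin n) (Fin n) ℝ} {r : ℝ} {k : ℕ}
    {M : ℝ[X]} (hm : minpoly ℝ G = (X - C r) ^ (k + 1) * M) (hM : M.eval r ≠ 0) :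
    ∃ c : ℂ → ℕ → ℂ, IsExpansion γ G c ∧ c (r : ℂ) (maxJordanBlock G (r : ℂ)) =
      ((-r * rowSum γ (aeval G ((X - C r) ^ k * M)) / (M.eval r * (k.factorial : ℝ)) : ℝ) : ℂ) := by
  have hrk : maxJordanBlock G (r : ℂ) = k + 1 := by
    rw [maxJordanBlock_ofReal, hm, rootMultiplicity_mul
      (hm ▸ minpoly.ne_zero (Matrix.isIntegral G)), rootMultiplicity_X_sub_C_pow,
      rootMultiplicity_eq_zero hM]
  have hrS : (r : ℂ) ∈ eigs G := by
    rw [ofReal_mem_eigs_iff, hm, IsRoot, eval_mul]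
    simp
  set mc := (minpoly ℝ G).map (algebraMap ℝ ℂ) with hmc
  have hprod := minpoly_map_eq_prod G
  have hmcz : aeval (toComplex G) mc = 0 := by
    rw [hmc, aeval_toComplex_map, minpoly.aeval, ← complexify_apply, map_zero]
  -- The spectral idempotents `e_μ = u_μ(G) P_μ(G)`, where `P_μ` is prime to `X - μ`.
  obtain ⟨u, hu⟩ := (exists_sum_eq_one_iff_pairwise_coprime (t := eigs G)
    (s := fun μ => (X - C μ) ^ maxJordanBlock G μ) ⟨_, hrS⟩).2
    (fun μ κ hne => (pairwise_coprime_X_sub_C Function.injective_id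
      (fun h => hne (Subtype.ext h))).pow)
  set Q : ℂ → ℂ[X] := fun μ => ∏ κ ∈ eigs G \ {μ}, (X - C κ) ^ maxJordanBlock G κ with hQ
  have hQmul : ∀ μ ∈ eigs G, (X - C μ) ^ maxJordanBlock G μ * Q μ = mc := fun μ hμ => by
    rw [hmc, hprod, hQ, ← Finset.mul_prod_erase _ _ hμ, ← Finset.sdiff_singleton_eq_erase]
  have haeval : ∀ μ : ℂ, aeval (toComplex G) (X - C μ) = toComplex G - μ • 1 := fun μ => by
    rw [map_sub, aeval_X, aeval_C, Algebra.algebraMap_eq_smul_one]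
  set e : ℂ → Matrix (Fin n) (Fin n) ℂ := fun μ => aeval (toComplex G) (u μ * Q μ) with he
  have hesum : ∑ μ ∈ eigs G, e μ = 1 := by
    rw [he, ← map_sum, hu, map_one]
  have hez : ∀ μ ∈ eigs G, (toComplex G - μ • 1) ^ maxJordanBlock G μ * e μ = 0 := fun μ hμ => by
    rw [← haeval, he, ← map_pow, ← map_mul, mul_left_comm, hQmul μ hμ, map_mul, hmcz, mul_zero]
  refine ⟨fun μ j => -rowSumComplex γ (toComplex G * ((toComplex G - μ • 1) ^ (j - 1) * e μ)) /
    ((j - 1).factorial : ℂ), fun x hx => ?_, ?_⟩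
  · have hexp : NormedSpace.exp ((x : ℂ) • toComplex G) = ∑ μ ∈ eigs G,
        ∑ j ∈ Finset.range (maxJordanBlock G μ),
          ((x : ℂ) ^ j / (j.factorial : ℂ) * Complex.exp (μ * x)) •
            ((toComplex G - μ • 1) ^ j * e μ) := by
      have h1 := congrArg (NormedSpace.exp ((x : ℂ) • toComplex G) * ·) hesum
      simp only [Finset.mul_sum, mul_one] at h1
      rw [← h1]
      exact Finset.sum_congr rfl fun μ hμ => exp_smul_mul_of_pow_mul_eq_zero (hez μ hμ) x
    have hd : (meDensity γ G x : ℂ) =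
        -rowSumComplex γ (toComplex G * NormedSpace.exp ((x : ℂ) • toComplex G)) := by
      rw [meDensity_eq, Complex.ofReal_neg, ← rowSumComplex_toComplex, ← complexify_apply, map_mul,
        complexify_apply, complexify_apply, toComplex_exp_smul]
    rw [hd, hexp, Finset.mul_sum, map_sum, ← Finset.sum_neg_distrib]
    refine Finset.sum_congr rfl fun μ _ => ?_
    have hshift : ∀ (N : ℕ) (f : ℕ → ℂ),
        ∑ j ∈ Finset.Icc 1 N, f j = ∑ j ∈ Finset.range N, f (j + 1) := fun N f => by
      rw [Finset.range_eq_Ico, Finset.sum_Ico_add' f 0 N 1]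
      rfl
    rw [Finset.mul_sum, map_sum, ← Finset.sum_neg_distrib, hshift]
    refine Finset.sum_congr rfl fun j _ => ?_
    simp only [Matrix.mul_smul, map_smul, smul_eq_mul, add_tsub_cancel_right]
    ring
  · -- Modulo the minimal polynomial, `(X - r)^k u_r P_r` is `(X - r)^k M / M(r)`.
    have hQr : Q r = M.map (algebraMap ℝ ℂ) := by
      have h1 := hQmul r hrS
      rw [hrk, hmc, hm, Polynomial.map_mul, Polynomial.map_pow, Polynomial.map_sub, map_X,
        map_C] at h1
      exact mul_left_cancel₀ (pow_ne_zero _ (X_sub_C_ne_zero _)) h1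
    have hur : (u r).eval (r : ℂ) * ((M.eval r : ℝ) : ℂ) = 1 := by
      have h1 := congrArg (eval (r : ℂ)) hu
      rw [eval_finsetSum, Finset.sum_eq_single_of_mem _ hrS, eval_mul, eval_one] at h1
      · rw [← h1, show ∏ κ ∈ eigs G \ {(r : ℂ)}, (X - C κ) ^ maxJordanBlock G κ = Q r from rfl, hQr]
        congr 1
        exact (eval_map_apply (f := algebraMap ℝ ℂ) r).symm
      · intro μ hμ hne
        rw [eval_mul, eval_prod, Finset.prod_eq_zero (i := (r : ℂ))]
        · simp
        · simp [hrS, hne.symm]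
        · simp [hrk]
    have hMc : ((M.eval r : ℝ) : ℂ) ≠ 0 := by exact_mod_cast hM
    obtain ⟨w, hw⟩ : X - C (r : ℂ) ∣ u r - C (((M.eval r : ℝ) : ℂ)⁻¹) := by
      rw [dvd_iff_isRoot, IsRoot, eval_sub, eval_C, eq_inv_of_mul_eq_one_left hur, sub_self]
    have hpoly : (X - C (r : ℂ)) ^ k * (u r * Q r) =
        C (((M.eval r : ℝ) : ℂ)⁻¹) * ((X - C r) ^ k * M).map (algebraMap ℝ ℂ) + w * mc := by
      rw [← hQmul r hrS, hrk, eq_add_of_sub_eq hw, hQr]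
      simp only [Polynomial.map_mul, Polynomial.map_pow, Polynomial.map_sub, map_X, map_C]
      rw [show (algebraMap ℝ ℂ) r = (r : ℂ) from rfl]
      ring
    have htop : (toComplex G - (r : ℂ) • 1) ^ k * e r =
        ((M.eval r : ℝ) : ℂ)⁻¹ • toComplex (aeval G ((X - C r) ^ k * M)) := by
      rw [← haeval, he, ← map_pow, ← map_mul, hpoly, map_add, map_mul, map_mul, aeval_C, hmcz,
        mul_zero, add_zero, aeval_toComplex_map, Algebra.algebraMap_eq_smul_one, Matrix.smul_mul,
        one_mul]
    have hGDc : toComplex G * toComplex (aeval G ((X - C r) ^ k * M)) =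
        toComplex (r • aeval G ((X - C r) ^ k * M)) := by
      rw [← mul_aeval_eq_smul hm, ← complexify_apply, ← complexify_apply, ← complexify_apply,
        ← map_mul]
    simp only [hrk, add_tsub_cancel_right]
    rw [htop, Matrix.mul_smul, map_smul, hGDc, rowSumComplex_toComplex, map_smul]
    push_cast [smul_eq_mul]
    field_simp

/-! ### Minimal representations -/

/-- The polynomials `p` for which `p(A)` is invisible through `α` and `𝟏`, that is,
`α g(A) p(A) 𝟏 = 0` for all `g`. -/
def annihilator {n : ℕ} (α : Fin n → ℝ) (A : Matrix (Fin n) (Fin n) ℝ) : Ideal ℝ[X] where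
  carrier := {p | ∀ g : ℝ[X], rowSum α (aeval A (g * p)) = 0}
  add_mem' hp hq g := by rw [mul_add, map_add, map_add, hp g, hq g, add_zero]
  zero_mem' g := by simp
  smul_mem' c p hp g := by rw [smul_eq_mul, ← mul_assoc]; exact hp _

theorem mem_annihilator_of_aeval_eq_zero {n : ℕ} {α : Fin n → ℝ} {A : Matrix (Fin n) (Fin n) ℝ}
    {p : ℝ[X]} (hp : aeval A p = 0) : p ∈ annihilator α A := fun g => by
  rw [map_mul, hp, mul_zero, map_zero]

theorem exists_monic_generator_annihilator {n : ℕ} (α : Fin n → ℝ)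
    (A : Matrix (Fin n) (Fin n) ℝ) :
    ∃ q : ℝ[X], q.Monic ∧ ∀ p, p ∈ annihilator α A ↔ q ∣ p := by
  obtain ⟨g, hg⟩ := (IsPrincipalIdealRing.principal (annihilator α A)).principal
  have hmem : ∀ p, p ∈ annihilator α A ↔ g ∣ p := fun p => by
    rw [hg]; exact Ideal.mem_span_singleton
  have hg0 : g ≠ 0 := by
    rintro rfl
    exact A.charpoly_monic.ne_zero (zero_dvd_iff.1 ((hmem _).1
      (mem_annihilator_of_aeval_eq_zero A.aeval_self_charpoly)))
  exact ⟨normalize g, monic_normalize hg0, fun p => by rw [hmem, normalize_dvd_iff]⟩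

/-- For a non-singular matrix the moments starting from `α A 𝟏` determine the annihilator: the
inverse is a polynomial in the matrix. -/
theorem mem_annihilator_of_rowSum_mul {n : ℕ} {α : Fin n → ℝ} {A : Matrix (Fin n) (Fin n) ℝ}
    (hA : IsUnit A.det) {p : ℝ[X]} (hp : ∀ g : ℝ[X], rowSum α (A * aeval A (g * p)) = 0) :
    p ∈ annihilator α A := by
  intro g
  have h0 : A.charpoly.coeff 0 ≠ 0 := by
    intro h
    rw [Matrix.det_eq_sign_charpoly_coeff, h, mul_zero] at hA
    exact not_isUnit_zero hA
  have h1 : rowSum α (aeval A (g * p * A.charpoly)) = 0 := by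
    rw [map_mul, Matrix.aeval_self_charpoly, mul_zero, map_zero]
  have h2 : g * p * A.charpoly =
      X * (A.charpoly.divX * g * p) + A.charpoly.coeff 0 • (g * p) := by
    conv_lhs => rw [← divX_mul_X_add A.charpoly]
    rw [smul_eq_C_mul]
    ring
  rw [h2, map_add, map_mul, aeval_X, map_add, hp, map_smul, map_smul, zero_add, smul_eq_mul] at h1
  exact (mul_eq_zero.1 h1).resolve_left h0

theorem exists_linearEquiv_map_eq_one {V : Type*} [AddCommGroup V] [Module ℝ V] {d : ℕ}
    (b : Module.Basis (Fin d) ℝ V) {v : V} (hv : v ≠ 0) :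
    ∃ e : V ≃ₗ[ℝ] (Fin d → ℝ), e v = 1 := by
  have h1 : b.equivFun v ≠ 0 := fun h => hv (b.equivFun.map_eq_zero_iff.1 h)
  have h2 : (1 : Fin d → ℝ) ≠ 0 := by
    obtain ⟨i, -⟩ := Function.ne_iff.1 h1
    exact fun h => one_ne_zero (congrFun h i)
  obtain ⟨T, hT⟩ := SeparatingDual.exists_continuousLinearEquiv_apply_eq (R := ℝ) h1 h2
  exact ⟨b.equivFun.trans T.toLinearEquiv, hT⟩

/-- A representation whose order is the degree of the generator `q` of the annihilator:
multiplication by `X` on `ℝ[X] / (q)`, in a basis whose elements add up to the class of `1`. -/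
theorem exists_realization {n : ℕ} {α : Fin n → ℝ} {A : Matrix (Fin n) (Fin n) ℝ} {q : ℝ[X]}
    (hq : q.Monic) (hann : ∀ p, q ∣ p → p ∈ annihilator α A) (hdeg : q ≠ 1) :
    ∃ (γ : Fin q.natDegree → ℝ) (G : Matrix (Fin q.natDegree) (Fin q.natDegree) ℝ),
      ∀ k : ℕ, rowSum γ (G ^ k) = rowSum α (A ^ k) := by
  have : Nontrivial (AdjoinRoot q) :=
    AdjoinRoot.nontrivial q (fun h => hdeg (hq.degree_le_zero_iff_eq_one.1 h.le))
  obtain ⟨e, he⟩ : ∃ e : AdjoinRoot q ≃ₗ[ℝ] (Fin q.natDegree → ℝ), e 1 = 1 :=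
    exists_linearEquiv_map_eq_one ((AdjoinRoot.powerBasis' hq).basis.reindex
      (finCongr (AdjoinRoot.powerBasis'_dim hq))) one_ne_zero
  choose p hp using fun i => AdjoinRoot.mk_surjective (e.symm (Pi.single i 1))
  set T : (Fin q.natDegree → ℝ) →ₗ[ℝ] (Fin q.natDegree → ℝ) :=
    e.toLinearMap ∘ₗ LinearMap.mulLeft ℝ (AdjoinRoot.root q) ∘ₗ e.symm.toLinearMap with hT
  refine ⟨fun i => rowSum α (aeval A (p i)), LinearMap.toMatrix' T, fun k => ?_⟩
  have hpow : ∀ k : ℕ, (LinearMap.toMatrix' T ^ k).mulVec 1 = e (AdjoinRoot.mk q (X ^ k)) := by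
    intro k
    induction k with
    | zero => simp [he]
    | succ k ih =>
      rw [pow_succ', ← Matrix.mulVec_mulVec, ih, LinearMap.toMatrix'_mulVec, hT]
      simp [pow_succ']
  -- A polynomial and the combination of the `p i` with the coordinates of its class agree mod `q`.
  have hdvd : q ∣ X ^ k - ∑ i, e (AdjoinRoot.mk q (X ^ k)) i • p i := by
    rw [← AdjoinRoot.mk_eq_zero, map_sub, sub_eq_zero]
    apply e.injective
    have h1 : AdjoinRoot.mk q (∑ i, e (AdjoinRoot.mk q (X ^ k)) i • p i) =
        ∑ i, e (AdjoinRoot.mk q (X ^ k)) i • e.symm (Pi.single i 1) := by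
      rw [map_sum]
      exact Finset.sum_congr rfl fun i _ => by rw [← AdjoinRoot.smul_mk, hp]
    rw [h1, map_sum]
    simp_rw [map_smul, LinearEquiv.apply_symm_apply]
    exact pi_eq_sum_univ' _
  have h2 := hann _ hdvd 1
  rw [one_mul, map_sub, map_sub, sub_eq_zero, map_pow, aeval_X, map_sum, map_sum] at h2
  rw [h2]
  simp only [rowSum, LinearMap.coe_mk, AddHom.coe_mk]
  rw [← Matrix.dotProduct_mulVec, hpow, dotProduct]
  refine Finset.sum_congr rfl fun i _ => ?_
  rw [map_smul, Matrix.vecMul_smul, smul_dotProduct, smul_eq_mul, mul_comm]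

/-- In a minimal representation the matrix has the generator of the annihilator both as its
characteristic and as its minimal polynomial: it divides both, and the characteristic polynomial
has no larger degree since there is a representation of order `q.natDegree`. -/
theorem IsMinimalRep.charpoly_eq {ν : Measure ℝ} {m n : ℕ} {α : Fin n → ℝ}
    {A : Matrix (Fin n) (Fin n) ℝ} {γ : Fin m → ℝ} {G : Matrix (Fin m) (Fin m) ℝ}
    (hG : IsMinimalRep ν γ G) (hA : IsME ν α A) (hdet : IsUnit A.det) {q : ℝ[X]} (hq : q.Monic)
    (hann : ∀ p, p ∈ annihilator α A ↔ q ∣ p) (hq1 : q ≠ 1) :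
    G.charpoly = q ∧ minpoly ℝ G = q := by
  have hmom := rowSum_mul_aeval_eq (rowSum_pow_eq_of_meDensity_eq
    fun x hx => hA.meDensity_eq_of_nonneg hG.1 hx)
  have hqG : ∀ p, aeval G p = 0 → q ∣ p := fun p hp =>
    (hann p).1 (mem_annihilator_of_rowSum_mul hdet fun g => by
      rw [hmom, map_mul (aeval G), hp, mul_zero, mul_zero, map_zero])
  obtain ⟨γ', G', hk⟩ := exists_realization hq (fun p => (hann p).2) hq1
  have hle : m ≤ q.natDegree := hG.2 _ γ' G'
    (hA.of_meDensity_eq (meDensity_eq_of_rowSum_pow_eq fun k => (hk (k + 1)).symm))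
  have hchar : G.charpoly = q := by
    refine (eq_of_monic_of_dvd_of_natDegree_le hq G.charpoly_monic
      (hqG _ G.aeval_self_charpoly) ?_)
    rwa [Matrix.charpoly_natDegree_eq_dim, Fintype.card_fin]
  have hint := Matrix.isIntegral (R := ℝ) G
  exact ⟨hchar, eq_of_monic_of_associated (minpoly.monic hint) hq
    (associated_of_dvd_dvd (hchar ▸ G.minpoly_dvd_charpoly) (hqG _ (minpoly.aeval ℝ G)))⟩

theorem exists_isMinimalRep {ν : Measure ℝ} {n : ℕ} {α : Fin n → ℝ}
    {A : Matrix (Fin n) (Fin n) ℝ} (hA : IsME ν α A) :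
    ∃ (m : ℕ) (γ : Fin m → ℝ) (G : Matrix (Fin m) (Fin m) ℝ), IsMinimalRep ν γ G := by
  classical
  have hex : ∃ m : ℕ, ∃ (γ : Fin m → ℝ) (G : Matrix (Fin m) (Fin m) ℝ), IsME ν γ G :=
    ⟨n, α, A, hA⟩
  obtain ⟨γ, G, hG⟩ := Nat.find_spec hex
  exact ⟨_, γ, G, hG, fun m γ' G' h => Nat.find_min' hex ⟨γ', G', h⟩⟩

theorem contributesMaximally_of_pos {n : ℕ} {γ : Fin n → ℝ} {G : Matrix (Fin n) (Fin n) ℝ}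
    {r : ℝ} {k : ℕ} {M : ℝ[X]} (hm : minpoly ℝ G = (X - C r) ^ (k + 1) * M) (hM : 0 < M.eval r)
    (h : rowSum γ (G * aeval G ((X - C r) ^ k * M)) < 0) : ContributesMaximally γ G r := by
  obtain ⟨c, hc, hck⟩ := exists_isExpansion γ hm hM.ne'
  refine ⟨c, _, hc, ?_, hck⟩
  rw [mul_aeval_eq_smul hm, map_smul, smul_eq_mul] at h
  exact div_pos (by linarith) (mul_pos hM (by positivity))

theorem eval_pos_of_dvd_minpoly {n : ℕ} {A : Matrix (Fin n) (Fin n) ℝ} {r : ℝ}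
    (hr : IsDominantEigenvalue A (r : ℂ)) {P : ℝ[X]} (hP : P.Monic) (hdvd : P ∣ minpoly ℝ A)
    (hPr : P.eval r ≠ 0) : 0 < P.eval r := by
  refine eval_pos_of_forall_not_isRoot hP fun u hu hroot => ?_
  have hne : u ≠ r := fun h => hPr (h ▸ hroot)
  have h1 := hr.2 u ((ofReal_mem_eigs_iff A u).2 (hroot.dvd hdvd))
    (fun h => hne (Complex.ofReal_injective h))
  rw [Complex.ofReal_re, Complex.ofReal_re] at h1
  exact absurd hu (not_le.2 h1)

/-- Since `(X - r)^k M` is not annihilated, the generator `q` of the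
annihilator contains the full power `(X - r)^(k+1)` of the minimal polynomial, and the values of
the functional at the cofactors of `q` and of the minimal polynomial have the same sign. -/
theorem exists_generator_factorization {n : ℕ} {α : Fin n → ℝ} {A : Matrix (Fin n) (Fin n) ℝ}
    {r : ℝ} {k : ℕ} {M q : ℝ[X]} (hr : IsDominantEigenvalue A (r : ℂ))
    (hm : minpoly ℝ A = (X - C r) ^ (k + 1) * M) (hM : 0 < M.eval r) (hq : q.Monic)
    (hann : ∀ p, p ∈ annihilator α A ↔ q ∣ p)
    (hpos : 0 < rowSum α (aeval A ((X - C r) ^ k * M))) :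
    ∃ P : ℝ[X], q = (X - C r) ^ (k + 1) * P ∧ 0 < P.eval r ∧
      0 < rowSum α (aeval A ((X - C r) ^ k * P)) := by
  have hqm : q ∣ minpoly ℝ A :=
    (hann _).1 (mem_annihilator_of_aeval_eq_zero (minpoly.aeval ℝ A))
  obtain ⟨P, hqP, hPr⟩ := exists_eq_pow_rootMultiplicity_mul_and_not_dvd q hq.ne_zero r
  have hPr0 : P.eval r ≠ 0 := fun h => hPr (dvd_iff_isRoot.2 h)
  have hPmonic : P.Monic := ((monic_X_sub_C r).pow _).of_mul_monic_left (hqP ▸ hq)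
  have hPm : P ∣ minpoly ℝ A := (Dvd.intro_left _ hqP.symm).trans hqm
  have hPpos := eval_pos_of_dvd_minpoly hr hPmonic hPm hPr0
  have hPM : P ∣ M := by
    have hcop : IsCoprime P ((X - C r) ^ (k + 1)) :=
      (((irreducible_X_sub_C r).coprime_iff_not_dvd).2 hPr).symm.pow_right
    exact hcop.dvd_of_dvd_mul_left (hm ▸ hPm)
  have hj : q.rootMultiplicity r = k + 1 := by
    refine le_antisymm ?_ ?_
    · have h1 := rootMultiplicity_le_rootMultiplicity_of_dvd
        (minpoly.ne_zero (Matrix.isIntegral A)) hqm r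
      rwa [hm, rootMultiplicity_mul (hm ▸ minpoly.ne_zero (Matrix.isIntegral A)),
        rootMultiplicity_X_sub_C_pow, rootMultiplicity_eq_zero hM.ne', add_zero] at h1
    · by_contra! hlt
      have hdvd : q ∣ (X - C r) ^ k * M := by
        rw [hqP]
        exact mul_dvd_mul (pow_dvd_pow _ (Nat.lt_succ_iff.1 hlt)) hPM
      have h1 := (hann _).2 hdvd 1
      rw [one_mul] at h1
      exact hpos.ne' h1
  rw [hj] at hqP
  refine ⟨P, hqP, hPpos, ?_⟩
  obtain ⟨w, rfl⟩ := hPM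
  obtain ⟨v, hv⟩ := X_sub_C_dvd_sub_C_eval (a := r) (p := w)
  -- Modulo `q`, the cofactor `w` acts on `(X - r)^k P` as the positive scalar `w(r)`.
  have h1 : (X - C r) ^ k * (P * w) = w.eval r • ((X - C r) ^ k * P) + v * q := by
    rw [hqP, smul_eq_C_mul, eq_add_of_sub_eq hv, eval_add]
    simp
    ring
  rw [h1, map_add, map_add, (hann q).2 dvd_rfl v, add_zero, map_smul, map_smul,
    smul_eq_mul] at hpos
  rw [eval_mul] at hM
  exact pos_of_mul_pos_right hpos (pos_of_mul_pos_right hM hPpos.le).le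

end

end PhaseType

theorem mainTheorem5 {Ω : Type*} [MeasurableSpace Ω] (P : MeasureTheory.Measure Ω)
    [MeasureTheory.IsProbabilityMeasure P] (X : Ω → ℝ) (hX : AEMeasurable X P)
    {n : ℕ} (α : Fin n → ℝ) (A : Matrix (Fin n) (Fin n) ℝ)
    (hPH : PhaseType.IsPH (P.map X) α A) (hNR : PhaseType.IsNonRedundant α A) :
    PhaseType.DominantEigenvalueCondition (P.map X) ∧
    ∃ r : ℝ,
      PhaseType.IsDominantEigenvalue A (r : ℂ) ∧
      PhaseType.ContributesMaximally α A r ∧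
      ∀ (m : ℕ) (γ : Fin m → ℝ) (G : Matrix (Fin m) (Fin m) ℝ),
        PhaseType.IsMinimalRep (P.map X) γ G →
          PhaseType.IsDominantEigenvalue G (r : ℂ) ∧
          PhaseType.algMult G (r : ℂ) = PhaseType.maxJordanBlock A (r : ℂ) ∧
          PhaseType.ContributesMaximally γ G r := by
  open PhaseType Polynomial in
  have : NeZero n := ⟨by
    rintro rfl
    simpa using hPH.init_sum⟩
  obtain ⟨r, hr, hD⟩ := exists_isDominantEigenvalue_of_offdiag_nonneg hPH.offdiag_nonneg
  have hroot := (ofReal_mem_eigs_iff A r).1 hr.1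
  have hm0 := minpoly.ne_zero (Matrix.isIntegral (R := ℝ) A)
  obtain ⟨M, hm, hMr⟩ := exists_eq_pow_rootMultiplicity_mul_and_not_dvd (minpoly ℝ A) hm0 r
  obtain ⟨k, hk⟩ := Nat.exists_eq_succ_of_ne_zero
    ((rootMultiplicity_pos hm0).2 hroot).ne'
  rw [hk, Nat.succ_eq_add_one] at hm
  have hMmonic : M.Monic := ((monic_X_sub_C r).pow _).of_mul_monic_left
    (hm ▸ minpoly.monic (Matrix.isIntegral A))
  have hMpos : 0 < M.eval r := eval_pos_of_dvd_minpoly hr hMmonic (Dvd.intro_left _ hm.symm)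
    fun h => hMr (dvd_iff_isRoot.2 h)
  have hdiv : minpoly ℝ A /ₘ (Polynomial.X - C r) = (Polynomial.X - C r) ^ k * M := by
    rw [hm, pow_succ', mul_assoc, mul_divByMonic_cancel_left _ (monic_X_sub_C r)]
  have hD0 := aeval_minpoly_divByMonic_ne_zero A hroot
  rw [hdiv] at hD hD0
  have hAD := mul_aeval_eq_smul hm
  have hDpos := rowSum_pos_of_isNonRedundant hPH.init_nonneg hPH.offdiag_nonneg hNR hAD hD hD0
  have hr0 : r < 0 := by
    refine lt_of_le_of_ne ?_ ?_
    · exact eigenvalue_nonpos_of_mul_eq_smul hPH.offdiag_nonneg hPH.row_sum_nonpos hAD hD hD0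
    · rintro rfl
      rw [zero_smul] at hAD
      apply hD0
      have h1 := congrArg (A⁻¹ * ·) hAD
      simpa [← mul_assoc, Matrix.nonsing_inv_mul A hPH.nonsingular] using h1
  obtain ⟨q, hq, hann⟩ := exists_monic_generator_annihilator α A
  obtain ⟨Q, hqQ, hQpos, hDQ⟩ := exists_generator_factorization hr hm hMpos hq hann hDpos
  have hq1 : q ≠ 1 := by
    intro h
    have h1 := congrArg (eval r) (h.symm.trans hqQ)
    simp at h1
  have hmin : ∀ (m : ℕ) (γ : Fin m → ℝ) (G : Matrix (Fin m) (Fin m) ℝ),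
      IsMinimalRep (P.map X) γ G → IsDominantEigenvalue G (r : ℂ) ∧
        algMult G (r : ℂ) = maxJordanBlock A (r : ℂ) ∧ ContributesMaximally γ G r := by
    intro m γ G hG
    obtain ⟨hchar, hminp⟩ := hG.charpoly_eq hPH.toIsME hPH.nonsingular hq hann hq1
    refine ⟨⟨?_, fun κ hκ => hr.2 κ ?_⟩, ?_, ?_⟩
    · rw [ofReal_mem_eigs_iff, hminp, hqQ, IsRoot, eval_mul]
      simp
    · rw [mem_eigs_iff_isRoot_minpoly, hminp] at hκ
      rw [mem_eigs_iff_isRoot_minpoly]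
      exact hκ.dvd (Polynomial.map_dvd _
        ((hann _).1 (mem_annihilator_of_aeval_eq_zero (minpoly.aeval ℝ A))))
    · rw [algMult_ofReal, hchar, maxJordanBlock_ofReal, hk, hqQ,
        rootMultiplicity_mul (hqQ ▸ hq.ne_zero), rootMultiplicity_X_sub_C_pow,
        rootMultiplicity_eq_zero hQpos.ne']
    · refine contributesMaximally_of_pos (hminp.trans hqQ) hQpos ?_
      have h1 := rowSum_mul_aeval_eq (rowSum_pow_eq_of_meDensity_eq
        fun x hx => hPH.toIsME.meDensity_eq_of_nonneg hG.1 hx) ((Polynomial.X - C r) ^ k * Q)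
      -- Modulo `q`, multiplication by `A` is multiplication by `r`.
      have h2 := mul_aeval_eq_add A r ((Polynomial.X - C r) ^ k * Q)
      rw [← mul_assoc (Polynomial.X - C r), ← pow_succ', ← hqQ, ← one_mul q] at h2
      rw [← h1, h2, map_add, (hann q).2 dvd_rfl 1, add_zero, map_smul, smul_eq_mul]
      exact mul_neg_of_neg_of_pos hr0 hDQ
  obtain ⟨m, γ, G, hG⟩ := exists_isMinimalRep hPH.toIsME
  refine ⟨⟨m, γ, G, hG, r, (hmin m γ G hG).1⟩, r, hr, ?_, hmin⟩
  refine contributesMaximally_of_pos hm hMpos ?_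
  rw [hAD, map_smul, smul_eq_mul]
  exact mul_neg_of_neg_of_pos hr0 hDpos
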